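/- Let $X$ be a complex Banach space, $L(X)$ the algebra of bounded linear operators on $X$, and $T\in L(X)$. Throughout, $\sigma_*$ is one of the following: the spectrum $\sigma$; the Browder spectrum $\sigma_b(T)=\{z: T-zI$ is not Browder$\}$, where Browder means Fredholm with finite ascent and finite descent; the Drazin spectrum $\sigma_d(T)=\{z: T-zI$ is not Drazin invertible$\}$, where Drazin invertible means having finite ascent and finite descent. For $A\subset\mathbb C$ let $\mathrm{acc}\,A$ be the set of accumulation points of $A$, and define the Cantor–Bendixson derivatives by $\mathrm{acc}^0A=A$, $\mathrm{acc}^{\beta+1}A=\mathrm{acc}(\mathrm{acc}^{\beta}A)$, and $\mathrm{acc}^{\delta}A=\bigcap_{\beta<\delta}\mathrm{acc}^{\beta}A$ for limit ordinals $\delta$. Write $(M,N)\in\mathrm{Red}(T)$ if $M,N$ are closed $T$-invariant subspaces with $X=M\oplus N$; $T_M$ denotes the restriction of $T$ to $M$. Put $\mathrm{comm}(T)=\{S\in L(X): ST=TS\}$ and $\mathrm{comm}^2(T)=\{S\in L(X): SR=RS\text{ for all }R\in\mathrm{comm}(T)\}$, and write $(M,N)\in\mathrm{Red}^2(T)$ if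 $(M,N)\in\mathrm{Red}(S)$ for every $S\in\mathrm{comm}(T)$. For a successor ordinal $\alpha$ with predecessor $\alpha-1$, let $g^{\alpha}_{\sigma_*}\mathcal D(T)$ be the set of all $(M,N)\in\mathrm{Red}(T)$ such that $T_M$ is invertible and $\mathrm{acc}^{\alpha-1}\sigma_*(T_N)\subset\{0\}$, and let $\Pi^{\alpha}_{\sigma_*}(T)=\sigma(T)\setminus\mathrm{acc}^{\alpha-1}\sigma_*(T)$. A spectral set of $T$ is a subset of $\sigma(T)$ that is clopen in $\sigma(T)$. The operator $T$ is called $g^{0}_{\sigma_*}$-invertible if $0\notin\sigma_*(T)$; $g^{\alpha}_{\sigma_*}$-invertible, for a successor ordinal $\alpha$, if $g^{\alpha}_{\sigma_*}\mathcal D(T)\neq\emptyset$; and $g^{\alpha}_{\sigma_*}$-invertible, for a limit ordinal $\alpha$, if it is $g^{\beta}_{\sigma_*}$-invertible for some successor ordinal $\beta<\alpha$. **Theorem.** Let $\alpha\ge 1$ be a successor ordinal. For every $T\in L(X)$ the following statements are equivalent: (i) $T$ is $g^{\alpha}_{\sigma_*}$-invertible; (ii) $0\notin\mathrm{acc}^{\alpha}\sigma_*(T)$;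 (iii) there exists $(M,N)\in\mathrm{Red}^2(T)\cap g^{\alpha}_{\sigma_*}\mathcal D(T)$; (iv) there exists a spectral set $\tilde\sigma$ of $T$ such that $0\notin\sigma(T)\setminus\tilde\sigma$ and $\tilde\sigma\setminus\{0\}\subset\Pi^{\alpha}_{\sigma_*}(T)$; (v) there exists a bounded projection $P\in\mathrm{comm}(T)$ such that $T+P$ is $g^{\alpha-1}_{\sigma_*}$-invertible and $\mathrm{acc}^{\alpha-1}\sigma_*(TP)\subset\{0\}$; (vi) there exists a bounded projection $P\in\mathrm{comm}^2(T)$ such that $T+P$ is $g^{\alpha-1}_{\sigma_*}$-invertible and $\mathrm{acc}^{\alpha-1}\sigma_*(TP)\subset\{0\}$; (vii) there exists $S\in\mathrm{comm}(T)$ such that $S^2T=S$ and $\mathrm{acc}^{\alpha-1}\sigma_*(T-T^2S)\subset\{0\}$; (viii) there exists $S\in\mathrm{comm}^2(T)$ such that $S^2T=S$ and $\mathrm{acc}^{\alpha-1}\sigma_*(T-T^2S)\subset\{0\}$. -/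

import Mathlib

/-- The `α`-th Cantor-Bendixson derivative `acc^α A` of a set `A ⊆ ℂ`: `acc^0 A = A`,
`acc^(β+1) A = acc (acc^β A)` and, for a limit ordinal, the intersection of the earlier
derivatives; `derivedSet B` is the set of accumulation points of `B` in `ℂ`. -/
noncomputable def cbDeriv (A : Set ℂ) (α : Ordinal) : Set ℂ :=
  Ordinal.limitRecOn (motive := fun _ => Set ℂ) α A (fun _ B => derivedSet B)
    (fun δ _ D => ⋂ (β : Ordinal) (h : β < δ), D β h)

theorem cbDeriv_zero (A : Set ℂ) : cbDeriv A 0 = A :=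
  Ordinal.limitRecOn_zero (motive := fun _ => Set ℂ) _ _ _

theorem cbDeriv_add_one (A : Set ℂ) (β : Ordinal) :
    cbDeriv A (β + 1) = derivedSet (cbDeriv A β) :=
  Ordinal.limitRecOn_add_one (motive := fun _ => Set ℂ) _ _ _ _

theorem cbDeriv_limit (A : Set ℂ) (δ : Ordinal) (h : Order.IsSuccLimit δ) :
    cbDeriv A δ = ⋂ (β : Ordinal) (_ : β < δ), cbDeriv A β :=
  Ordinal.limitRecOn_limit (motive := fun _ => Set ℂ) _ _ _ _ h

section Operators

variable {X : Type*} [NormedAddCommGroup X] [NormedSpace ℂ X]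

/-- `T` has finite ascent: `N(T^n) = N(T^(n+1))` for some `n`. -/
def HasFiniteAscent (T : X →L[ℂ] X) : Prop :=
  ∃ n : ℕ, (T ^ n).ker = (T ^ (n + 1)).ker

/-- `T` has finite descent: `R(T^n) = R(T^(n+1))` for some `n`. -/
def HasFiniteDescent (T : X →L[ℂ] X) : Prop :=
  ∃ n : ℕ, (T ^ n).range = (T ^ (n + 1)).range

/-- `T` is Drazin invertible: it has finite ascent and finite descent. -/
def IsDrazinInvertible (T : X →L[ℂ] X) : Prop :=
  HasFiniteAscent T ∧ HasFiniteDescent T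

/-- `T` is a Browder operator: a Fredholm operator of finite ascent and finite descent. -/
def IsBrowder (T : X →L[ℂ] X) : Prop :=
  T.IsFredholm ∧ HasFiniteAscent T ∧ HasFiniteDescent T

/-- The Browder spectrum `σ_b(T)`. -/
def browderSpectrum (T : X →L[ℂ] X) : Set ℂ :=
  {z : ℂ | ¬ IsBrowder (T - z • (1 : X →L[ℂ] X))}

/-- The Drazin spectrum `σ_d(T)`. -/
def drazinSpectrum (T : X →L[ℂ] X) : Set ℂ :=
  {z : ℂ | ¬ IsDrazinInvertible (T - z • (1 : X →L[ℂ] X))}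

/-- The three choices for the symbol `σ_*`. -/
inductive SpectrumKind where
  | ordinary
  | browder
  | drazin

/-- The set `σ_*(T)`, for `σ_*` one of the spectrum `σ`, the Browder spectrum `σ_b` and the
Drazin spectrum `σ_d`. -/
def starSpectrum (s : SpectrumKind) (T : X →L[ℂ] X) : Set ℂ :=
  match s with
  | SpectrumKind.ordinary => spectrum ℂ T
  | SpectrumKind.browder => browderSpectrum T
  | SpectrumKind.drazin => drazinSpectrum T

/-- `(M, N) ∈ Red(T)`: `M` and `N` are closed `T`-invariant subspaces with `X = M ⊕ N`. -/
structure IsRed (T : X →L[ℂ] X) (M N : Submodule ℂ X) : Prop where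
  isClosed_left : IsClosed (M : Set X)
  isClosed_right : IsClosed (N : Set X)
  map_left : ∀ x ∈ M, T x ∈ M
  map_right : ∀ x ∈ N, T x ∈ N
  isCompl : IsCompl M N

/-- The commutant `comm(T)`: all bounded operators that commute with `T`. -/
def comm1 (T : X →L[ℂ] X) : Set (X →L[ℂ] X) := {S | S * T = T * S}

/-- The double commutant `comm²(T)`: all bounded operators that commute with every element
of `comm(T)`. -/
def comm2 (T : X →L[ℂ] X) : Set (X →L[ℂ] X) := {S | ∀ R ∈ comm1 T, S * R = R * S}

/-- `(M, N) ∈ Red²(T)`: the pair `(M, N)` belongs to `Red(S)` for every `S ∈ comm(T)`. -/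
def IsRedSq (T : X →L[ℂ] X) (M N : Submodule ℂ X) : Prop :=
  ∀ S ∈ comm1 T, IsRed S M N

/-- `(M, N) ∈ g^{γ+1}_{σ_*}D(T)`: `(M, N) ∈ Red(T)`, the restriction `T_M` is invertible and
`acc^γ σ_*(T_N) ⊆ {0}`. -/
def IsGDecomp (s : SpectrumKind) (γ : Ordinal) (T : X →L[ℂ] X) (M N : Submodule ℂ X) : Prop :=
  ∃ h : IsRed T M N, IsUnit (T.restrict h.map_left) ∧
    cbDeriv (starSpectrum s (T.restrict h.map_right)) γ ⊆ {0}

/-- `T` is `g^α_{σ_*}`-invertible; the three disjuncts treat `α = 0`, successor ordinals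
`α = γ + 1` and limit ordinals `α` (where some successor ordinal `γ + 1 < α` must work). -/
def IsGInvertible (s : SpectrumKind) (α : Ordinal) (T : X →L[ℂ] X) : Prop :=
  (α = 0 ∧ 0 ∉ starSpectrum s T) ∨
  (∃ γ : Ordinal, α = γ + 1 ∧ ∃ M N : Submodule ℂ X, IsGDecomp s γ T M N) ∨
  (Order.IsSuccLimit α ∧ ∃ γ : Ordinal, γ + 1 < α ∧ ∃ M N : Submodule ℂ X, IsGDecomp s γ T M N)

/-- `Π^{γ+1}_{σ_*}(T) = σ(T) \ acc^γ σ_*(T)`. -/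
noncomputable def specPi (s : SpectrumKind) (γ : Ordinal) (T : X →L[ℂ] X) : Set ℂ :=
  spectrum ℂ T \ cbDeriv (starSpectrum s T) γ

/-- A spectral set of `T`: a subset of `σ(T)` that is clopen in `σ(T)`. -/
def IsSpectralSet (T : X →L[ℂ] X) (A : Set ℂ) : Prop :=
  A ⊆ spectrum ℂ T ∧ IsClopen ((↑) ⁻¹' A : Set (spectrum ℂ T))

end Operators

open Filter Topology Set MeasureTheory
open scoped FourierTransform

/-! Three facts about `σ_*` carry the proof: `acc σ(T) ⊆ σ_*(T) ⊆ σ(T)`, hence `σ_*(T)` is closed,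
and `σ_*` of a direct sum is the union of the two parts. The first inclusion holds because a Drazin
invertible operator has only invertible small nonzero perturbations `T - z`.

Suppose `0 ∉ acc^(γ+1) σ_*(T)`, where `α = γ + 1`. Near `0` the set `acc^γ σ_*(T)` contains at most
`0`. Then `σ(T)` is countable near `0`: otherwise it would contain a nonempty perfect set there,
which lies in `acc σ(T) ⊆ σ_*(T)` and survives every derivative. So some circle of radius `ρ < 1`
misses `σ(T)`. Its interior gives the spectral set in (iv), and its Riesz idempotent `P`, which lies
in the double commutant, gives (iii), (vi) and (viii) (`exists_idempotent_of_zero_notMem_cbDeriv`).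

Conversely, the decompositions, projections and generalized inverses all split `T` into a part with
`0 ∉ acc^γ σ_*` and a part with `acc^γ σ_* ⊆ {0}`; one more derivative removes `0` from the union.
Statement (iv) returns to (ii) by topology alone. -/

/-! ### Cantor–Bendixson derivatives of plane sets -/

theorem cbDeriv_mono {A B : Set ℂ} (h : A ⊆ B) (α : Ordinal) : cbDeriv A α ⊆ cbDeriv B α := by
  induction α using Ordinal.limitRecOn with
  | zero => simpa [cbDeriv_zero] using h
  | add_one β ih =>
    rw [cbDeriv_add_one, cbDeriv_add_one]
    exact derivedSet_mono _ _ ih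
  | limit δ hδ ih =>
    rw [cbDeriv_limit _ _ hδ, cbDeriv_limit _ _ hδ]
    exact iInter₂_mono ih

theorem isClosed_cbDeriv {A : Set ℂ} (hA : IsClosed A) (α : Ordinal) :
    IsClosed (cbDeriv A α) := by
  induction α using Ordinal.limitRecOn with
  | zero => rwa [cbDeriv_zero]
  | add_one β ih =>
    rw [cbDeriv_add_one]
    exact isClosed_derivedSet _
  | limit δ hδ ih =>
    rw [cbDeriv_limit _ _ hδ]
    exact isClosed_biInter ih

theorem cbDeriv_antitone {A : Set ℂ} (hA : IsClosed A) : Antitone (cbDeriv A) := by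
  intro α β h
  induction β using Ordinal.limitRecOn with
  | zero => rw [nonpos_iff_eq_zero.mp h]
  | add_one β ih =>
    rcases h.eq_or_lt with rfl | h
    · exact subset_rfl
    · rw [cbDeriv_add_one]
      exact ((isClosed_iff_derivedSet_subset _).mp (isClosed_cbDeriv hA β)).trans
        (ih (Order.lt_add_one_iff.mp h))
  | limit δ hδ ih =>
    rcases h.eq_or_lt with rfl | h
    · exact subset_rfl
    · rw [cbDeriv_limit _ _ hδ]
      exact biInter_subset_of_mem h

theorem cbDeriv_subset {A : Set ℂ} (hA : IsClosed A) (α : Ordinal) : cbDeriv A α ⊆ A := by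
  simpa [cbDeriv_zero] using cbDeriv_antitone hA (bot_le : 0 ≤ α)

/-- At a limit, a point lost from `A` at stage `a` and from `B` at stage `b` is lost from both at
`max a b`, since derivatives of closed sets decrease. -/
theorem cbDeriv_union {A B : Set ℂ} (hA : IsClosed A) (hB : IsClosed B) (α : Ordinal) :
    cbDeriv (A ∪ B) α = cbDeriv A α ∪ cbDeriv B α := by
  induction α using Ordinal.limitRecOn with
  | zero => simp [cbDeriv_zero]
  | add_one β ih => rw [cbDeriv_add_one, ih, derivedSet_union, cbDeriv_add_one, cbDeriv_add_one]
  | limit δ hδ ih =>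
    rw [cbDeriv_limit _ _ hδ, cbDeriv_limit _ _ hδ, cbDeriv_limit _ _ hδ]
    refine subset_antisymm (fun x hx => ?_) (union_subset ?_ ?_)
    · simp only [mem_union, mem_iInter] at hx ⊢
      by_contra! hc
      obtain ⟨⟨a, ha, hxa⟩, ⟨b, hb, hxb⟩⟩ := hc
      have hx' := hx (max a b) (max_lt ha hb)
      rw [ih _ (max_lt ha hb)] at hx'
      rcases hx' with h | h
      · exact hxa (cbDeriv_antitone hA (le_max_left a b) h)
      · exact hxb (cbDeriv_antitone hB (le_max_right a b) h)
    · exact iInter₂_mono fun β hβ => (ih β hβ).symm ▸ subset_union_left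
    · exact iInter₂_mono fun β hβ => (ih β hβ).symm ▸ subset_union_right

theorem derivedSet_eq_empty_of_subset_singleton {A : Set ℂ} {a : ℂ} (h : A ⊆ {a}) :
    derivedSet A = ∅ := by
  ext x
  simp only [mem_derivedSet, accPt_iff_nhds, mem_empty_iff_false, iff_false]
  intro hx
  by_cases hxa : x = a
  · obtain ⟨y, hy, hne⟩ := hx univ univ_mem
    exact hne (by rw [h hy.2, hxa])
  · obtain ⟨y, hy, hne⟩ := hx {a}ᶜ (isOpen_compl_singleton.mem_nhds hxa)
    exact hy.1 (h hy.2)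

theorem cbDeriv_subset_singleton {A : Set ℂ} {a : ℂ} (h : A ⊆ {a}) (α : Ordinal) :
    cbDeriv A α ⊆ {a} :=
  (cbDeriv_subset (finite_singleton a |>.subset h).isClosed α).trans h

/-- If `acc^γ A` misses `0` and `acc^γ B ⊆ {0}`, then `0` is not in `acc^(γ+1) (A ∪ B)`. -/
theorem zero_notMem_cbDeriv_union {A B : Set ℂ} (hA : IsClosed A) (hB : IsClosed B) {γ : Ordinal}
    (h0 : 0 ∉ cbDeriv A γ) (h : cbDeriv B γ ⊆ {0}) : 0 ∉ cbDeriv (A ∪ B) (γ + 1) := by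
  rw [cbDeriv_add_one, cbDeriv_union hA hB, derivedSet_union,
    derivedSet_eq_empty_of_subset_singleton h, union_empty]
  exact fun hc => h0 ((isClosed_iff_derivedSet_subset _).mp (isClosed_cbDeriv hA γ) hc)

theorem Preperfect.subset_cbDeriv {D A : Set ℂ} (hD : Preperfect D) (h : D ⊆ A) (α : Ordinal) :
    D ⊆ cbDeriv A α := by
  induction α using Ordinal.limitRecOn with
  | zero => rwa [cbDeriv_zero]
  | add_one β ih =>
    rw [cbDeriv_add_one]
    exact (preperfect_iff_subset_derivedSet.mp hD).trans (derivedSet_mono _ _ ih)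
  | limit δ hδ ih =>
    rw [cbDeriv_limit _ _ hδ]
    exact subset_iInter₂ ih

/-- An uncountable closed set contains a nonempty perfect set `D`. Here `D ⊆ acc S ⊆ A`, so `D`
persists in every derivative of `A` and would have to lie in `{a}`, which no nonempty perfect set
does. -/
theorem countable_of_cbDeriv_inter_subset {S A C : Set ℂ} (hC : IsClosed C) (hCS : C ⊆ S)
    (hSA : derivedSet S ⊆ A) {γ : Ordinal} {a : ℂ} (h : cbDeriv A γ ∩ C ⊆ {a}) :
    C.Countable := by
  by_contra hunc
  obtain ⟨D, hD, ⟨x, hx⟩, hDC⟩ := exists_perfect_nonempty_of_isClosed_of_not_countable hC hunc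
  have hacc := preperfect_iff_subset_derivedSet.mp hD.acc
  have hDA : D ⊆ A := hacc.trans ((derivedSet_mono _ _ (hDC.trans hCS)).trans hSA)
  have hDa : D ⊆ {a} := (subset_inter (hD.acc.subset_cbDeriv hDA γ) hDC).trans h
  simpa [derivedSet_eq_empty_of_subset_singleton hDa] using hacc hx

theorem exists_sphere_inter_eq_empty {S A : Set ℂ} (hS : IsClosed S) (hSA : derivedSet S ⊆ A)
    {γ : Ordinal} (h : 0 ∉ cbDeriv A (γ + 1)) :
    ∃ ρ : ℝ, 0 < ρ ∧ ρ < 1 ∧ (∀ z ∈ S, ‖z‖ ≠ ρ) ∧ ∀ z ∈ cbDeriv A γ, ‖z‖ ≤ ρ → z = 0 := by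
  rw [cbDeriv_add_one, mem_derivedSet, accPt_iff_nhds] at h
  push Not at h
  obtain ⟨U, hU, hUA⟩ := h
  obtain ⟨r, hr, hrU⟩ := Metric.nhds_basis_closedBall.mem_iff.mp hU
  have hA : ∀ z ∈ cbDeriv A γ, ‖z‖ ≤ r → z = 0 := fun z hz hzr =>
    hUA z ⟨hrU (by simpa using hzr), hz⟩
  have hcount : (S ∩ Metric.closedBall 0 r).Countable := by
    refine countable_of_cbDeriv_inter_subset (hS.inter Metric.isClosed_closedBall)
      inter_subset_left hSA (γ := γ) (a := 0) ?_
    rintro z ⟨hz, -, hzr⟩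
    exact hA z hz (by simpa using hzr)
  -- Countably many norms cannot fill an interval. The bound `ρ < 1` later keeps `-1` outside the
  -- disc.
  have hne : ((Ioo 0 (min r 1)) \ (norm '' (S ∩ Metric.closedBall 0 r))).Nonempty := by
    by_contra hcon
    rw [not_nonempty_iff_eq_empty, sdiff_eq_empty] at hcon
    exact (Cardinal.Real.Ioo_countable_iff.not.mpr
      (not_le.mpr (lt_min hr one_pos))) ((hcount.image _).mono hcon)
  obtain ⟨ρ, ⟨h0, h1⟩, hρ⟩ := hne
  obtain ⟨hr1, hr2⟩ := lt_min_iff.mp h1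
  refine ⟨ρ, h0, hr2, fun z hz hzρ => hρ ⟨z, ⟨hz, ?_⟩, hzρ⟩, fun z hz hzρ => hA z hz (by linarith)⟩
  simpa [hzρ] using hr1.le

/-! ### Riesz idempotents from Fourier coefficients of the resolvent -/

section RieszProjection

variable {A : Type*} [NormedRing A] [NormedAlgebra ℂ A]

/-- The Fourier integral over one period of `t ↦ (1 - e^{2πit} a)⁻¹`. -/
noncomputable def circleResolventCoeff (a : A) (k : ℤ) : A :=
  ∫ t in (0 : ℝ)..1, Real.fourierChar (-(t * k)) • Ring.inverse (1 - (𝐞 t : ℂ) • a)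

variable {a : A}

theorem isUnit_one_sub_smul (ha : ∀ z ∈ spectrum ℂ a, ‖z‖ ≠ 1) {u : ℂ} (hu : ‖u‖ = 1) :
    IsUnit (1 - u • a) := by
  have hu0 : u ≠ 0 := by rintro rfl; simp at hu
  have h : u⁻¹ ∉ spectrum ℂ a := fun h => ha _ h (by simp [hu])
  rw [spectrum.notMem_iff] at h
  have h2 := h.smul (Units.mk0 u hu0)
  simpa [Units.smul_def, smul_sub, Algebra.algebraMap_eq_smul_one, smul_smul, hu0] using h2

/-- This is the Riemann–Lebesgue lemma for the integrand cut off to one period, read at integer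
frequencies. -/
theorem tendsto_circleResolventCoeff (a : A) :
    Tendsto (circleResolventCoeff a) cofinite (𝓝 0) := by
  have h := Real.tendsto_integral_exp_smul_cocompact
    ((Ioc (0 : ℝ) 1).indicator fun t : ℝ => Ring.inverse (1 - (𝐞 t : ℂ) • a))
  have h2 := h.comp (Int.tendsto_coe_cofinite)
  refine h2.congr fun k => ?_
  simp only [Function.comp_apply]
  rw [circleResolventCoeff, intervalIntegral.integral_of_le zero_le_one,
    ← integral_indicator measurableSet_Ioc]
  congr 1 with t
  by_cases ht : t ∈ Ioc (0 : ℝ) 1 <;> simp [ht]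

variable [CompleteSpace A]

theorem continuous_inverse_one_sub_smul (ha : ∀ z ∈ spectrum ℂ a, ‖z‖ ≠ 1) :
    Continuous fun t : ℝ => Ring.inverse (1 - (𝐞 t : ℂ) • a) := by
  rw [continuous_iff_continuousAt]
  intro t
  obtain ⟨u, hu⟩ := isUnit_one_sub_smul ha (Circle.norm_coe (𝐞 t))
  have h1 : ContinuousAt (fun t : ℝ => 1 - (𝐞 t : ℂ) • a) t := by
    have : Continuous fun t : ℝ => 𝐞 t := Real.continuous_fourierChar
    fun_prop
  have h2 := NormedRing.inverse_continuousAt u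
  rw [hu] at h2
  exact ContinuousAt.comp (f := fun t : ℝ => 1 - (𝐞 t : ℂ) • a) h2 h1

theorem continuous_circleResolvent_integrand (ha : ∀ z ∈ spectrum ℂ a, ‖z‖ ≠ 1) (k : ℤ) :
    Continuous fun t : ℝ => 𝐞 (-(t * k)) • Ring.inverse (1 - (𝐞 t : ℂ) • a) := by
  have h1 := continuous_inverse_one_sub_smul ha
  have h2 : Continuous fun t : ℝ => 𝐞 t := Real.continuous_fourierChar
  exact (h2.comp (by fun_prop : Continuous fun t : ℝ => -(t * k))).smul h1

theorem commute_circleResolventCoeff (ha : ∀ z ∈ spectrum ℂ a, ‖z‖ ≠ 1) {s : A}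
    (hs : Commute s a) (k : ℤ) : Commute s (circleResolventCoeff a k) := by
  have hi := ((continuous_circleResolvent_integrand ha k).intervalIntegrable
    (μ := volume) 0 1).1
  have hpt : ∀ t : ℝ, s * (𝐞 (-(t * k)) • Ring.inverse (1 - (𝐞 t : ℂ) • a)) =
      (𝐞 (-(t * k)) • Ring.inverse (1 - (𝐞 t : ℂ) • a)) * s := fun t => by
    have h : Commute s (Ring.inverse (1 - (𝐞 t : ℂ) • a)) := by
      obtain ⟨u, hu⟩ := isUnit_one_sub_smul ha (Circle.norm_coe (𝐞 t))
      rw [← hu, Ring.inverse_unit]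
      refine Commute.units_inv_right ?_
      rw [hu]
      exact (Commute.one_right s).sub_right (hs.smul_right _)
    rw [mul_smul_comm, smul_mul_assoc, h.eq]
  rw [commute_iff_eq, circleResolventCoeff, intervalIntegral.integral_of_le zero_le_one,
    ← integral_const_mul_of_integrable hi, ← integral_mul_const_of_integrable hi]
  simp_rw [hpt]

theorem integral_fourierChar_int (k : ℤ) (hk : k ≠ 0) :
    ∫ t in (0 : ℝ)..1, (𝐞 (-(t * k)) : ℂ) = 0 := by
  have hc : (-(2 * Real.pi * k) * Complex.I : ℂ) ≠ 0 := by
    simp [Real.pi_ne_zero, hk]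
  have : ∀ t : ℝ, (𝐞 (-(t * k)) : ℂ) = Complex.exp ((-(2 * Real.pi * k) * Complex.I) * t) := by
    intro t
    rw [Real.fourierChar_apply]
    congr 1
    push_cast
    ring
  simp_rw [this]
  rw [integral_exp_mul_complex hc]
  have h1 : Complex.exp (-(2 * Real.pi * k) * Complex.I * ((1 : ℝ) : ℂ)) = 1 := by
    rw [Complex.exp_eq_one_iff]
    exact ⟨-k, by push_cast; ring⟩
  rw [h1]
  simp

/-- These are the Fourier coefficients of `(1 - u a)(1 - u a)⁻¹ = 1`: multiplication by `u` shifts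
the index. Away from `k = 0` the recurrence can be iterated, upwards from `0` and downwards from
`-1`. -/
theorem circleResolventCoeff_sub (ha : ∀ z ∈ spectrum ℂ a, ‖z‖ ≠ 1) (k : ℤ) :
    circleResolventCoeff a k - a * circleResolventCoeff a (k - 1) = if k = 0 then 1 else 0 := by
  have hi : ∀ k, IntervalIntegrable _ volume (0 : ℝ) 1 := fun k =>
    (continuous_circleResolvent_integrand ha k).intervalIntegrable 0 1
  have h1 : a * circleResolventCoeff a (k - 1) = ∫ t in (0 : ℝ)..1,
      a * (𝐞 (-(t * (k - 1 : ℤ))) • Ring.inverse (1 - (𝐞 t : ℂ) • a)) := by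
    rw [circleResolventCoeff, intervalIntegral.integral_of_le zero_le_one,
      intervalIntegral.integral_of_le zero_le_one,
      integral_const_mul_of_integrable (hi (k - 1)).1]
  have h2 : IntervalIntegrable (fun t : ℝ =>
      a * (𝐞 (-(t * (k - 1 : ℤ))) • Ring.inverse (1 - (𝐞 t : ℂ) • a))) volume 0 1 :=
    (continuous_const.mul (continuous_circleResolvent_integrand ha (k - 1))).intervalIntegrable 0 1
  rw [h1, circleResolventCoeff, ← intervalIntegral.integral_sub (hi k) h2]
  have hpt : ∀ t : ℝ, 𝐞 (-(t * k)) • Ring.inverse (1 - (𝐞 t : ℂ) • a) -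
      a * (𝐞 (-(t * (k - 1 : ℤ))) • Ring.inverse (1 - (𝐞 t : ℂ) • a)) =
      (𝐞 (-(t * k)) : ℂ) • (1 : A) := by
    intro t
    have hu := isUnit_one_sub_smul ha (Circle.norm_coe (𝐞 t))
    have he : 𝐞 (-(t * (k - 1 : ℤ))) = 𝐞 (-(t * k)) * 𝐞 t := by
      rw [← AddChar.map_add_eq_mul]
      congr 1
      push_cast
      ring
    rw [he, Circle.smul_def, Circle.smul_def, Circle.coe_mul, mul_smul, mul_smul_comm, ← smul_sub]
    congr 1
    rw [mul_smul_comm, ← smul_mul_assoc]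
    nth_rw 1 [← one_mul (Ring.inverse (1 - (𝐞 t : ℂ) • a))]
    rw [← sub_mul, Ring.mul_inverse_cancel _ hu]
  simp_rw [hpt]
  rw [intervalIntegral.integral_smul_const]
  split_ifs with hk
  · simp [hk]
  · rw [integral_fourierChar_int k hk, zero_smul]

theorem circleResolventCoeff_natCast (ha : ∀ z ∈ spectrum ℂ a, ‖z‖ ≠ 1) (n : ℕ) :
    circleResolventCoeff a n = a ^ n * circleResolventCoeff a 0 := by
  induction n with
  | zero => simp
  | succ n ih =>
    have h := circleResolventCoeff_sub ha ((n : ℤ) + 1)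
    rw [if_neg (by positivity), add_sub_cancel_right, sub_eq_zero, ih, ← mul_assoc,
      ← pow_succ'] at h
    exact_mod_cast h

theorem circleResolventCoeff_neg_one (ha : ∀ z ∈ spectrum ℂ a, ‖z‖ ≠ 1) (n : ℕ) :
    circleResolventCoeff a (-1) = a ^ n * circleResolventCoeff a (-1 - n) := by
  induction n with
  | zero => simp
  | succ n ih =>
    have h := circleResolventCoeff_sub ha (-1 - n)
    rw [if_neg (by omega), sub_eq_zero] at h
    rw [ih, h, ← mul_assoc, ← pow_succ]
    push_cast
    congr 2
    ring

/-- The spectral idempotent of `a` for the part of the spectrum inside the unit circle. -/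
theorem exists_spectral_idempotent_unit (ha : ∀ z ∈ spectrum ℂ a, ‖z‖ ≠ 1) :
    ∃ p b : A, IsIdempotentElem p ∧ (∀ s, Commute s a → Commute s p ∧ Commute s b) ∧
      a * b = 1 - p ∧ ∀ z ∈ spectrum ℂ (a * p), ‖z‖ < 1 := by
  set c := circleResolventCoeff a with hc
  have hcomm : ∀ s, Commute s a → ∀ k, Commute s (c k) :=
    fun s hs k => commute_circleResolventCoeff ha hs k
  have hcc : ∀ j k, Commute (c j) (c k) := fun j k => hcomm _ (hcomm a rfl j).symm k
  have h0 : c 0 - a * c (-1) = 1 := by simpa using circleResolventCoeff_sub ha 0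
  have ht1 : Tendsto (fun n : ℕ => c n) atTop (𝓝 0) := by
    have := (tendsto_circleResolventCoeff a).comp
      (Nat.cast_injective (R := ℤ)).tendsto_cofinite
    rwa [Nat.cofinite_eq_atTop] at this
  have ht2 : Tendsto (fun n : ℕ => c (-1 - n)) atTop (𝓝 0) := by
    have hinj : Function.Injective fun n : ℕ => (-1 - n : ℤ) := fun m n h => by
      simpa using h
    have := (tendsto_circleResolventCoeff a).comp hinj.tendsto_cofinite
    rwa [Nat.cofinite_eq_atTop] at this
  -- For every `n`, `c 0 * c (-1) = c n * c (-1 - n)`, and the right side tends to `0`. With `c 0 -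
  -- a * c (-1) = 1` this makes `c 0` idempotent, with no double contour integral.
  have hzero : c 0 * c (-1) = 0 := by
    have h := ht1.mul ht2
    rw [mul_zero] at h
    refine tendsto_nhds_unique (tendsto_const_nhds.congr fun n => ?_) h
    rw [hc, circleResolventCoeff_natCast ha n, circleResolventCoeff_neg_one ha n, ← hc,
      ← mul_assoc, (((hcomm a rfl 0).symm).pow_right n).eq]
  have hp : IsIdempotentElem (c 0) := by
    have : c 0 * (c 0 - a * c (-1)) = c 0 * c 0 := by
      rw [mul_sub, ← mul_assoc, ← (hcomm a rfl 0).eq, mul_assoc, hzero, mul_zero, sub_zero]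
    rw [IsIdempotentElem, ← this, h0, mul_one]
  refine ⟨c 0, -c (-1), hp, fun s hs => ⟨hcomm s hs 0, (hcomm s hs (-1)).neg_right⟩, ?_, ?_⟩
  · rw [mul_neg, ← h0]
    abel
  · intro z hz
    -- The powers `(a * c 0) ^ (n + 1)` equal `c (n + 1)`, which tend to `0`; hence no spectral
    -- value has norm at least `1`.
    have hn : ∀ n : ℕ, ‖z‖ ^ (n + 1) ≤ ‖c (n + 1 : ℕ)‖ * ‖(1 : A)‖ := fun n => by
      have h := spectrum.norm_le_norm_mul_of_mem (spectrum.pow_mem_pow _ (n + 1) hz)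
      rwa [norm_pow, (hcomm a rfl 0).mul_pow, hp.pow_succ_eq, hc,
        ← circleResolventCoeff_natCast ha] at h
    have hlim : Tendsto (fun n : ℕ => ‖z‖ ^ (n + 1)) atTop (𝓝 0) := by
      refine squeeze_zero (fun n => by positivity) hn ?_
      simpa using ((tendsto_add_atTop_iff_nat 1).mpr ht1).norm.mul_const ‖(1 : A)‖
    by_contra! hz1
    exact absurd (ge_of_tendsto' hlim fun n => one_le_pow₀ hz1) (by norm_num)

/-- The spectral idempotent of `a` for the part of the spectrum inside the circle of radius `ρ`. -/
theorem exists_spectral_idempotent {ρ : ℝ} (hρ : 0 < ρ) (ha : ∀ z ∈ spectrum ℂ a, ‖z‖ ≠ ρ) :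
    ∃ p b : A, IsIdempotentElem p ∧ (∀ s, Commute s a → Commute s p ∧ Commute s b) ∧
      a * b = 1 - p ∧ ∀ z ∈ spectrum ℂ (a * p), ‖z‖ < ρ := by
  have hρ' : (ρ : ℂ)⁻¹ ≠ 0 := by simpa using hρ.ne'
  set u : ℂˣ := Units.mk0 _ hρ' with hu
  have key : ∀ (x : A) (z : ℂ), z ∈ spectrum ℂ x → (ρ : ℂ)⁻¹ * z ∈ spectrum ℂ ((ρ : ℂ)⁻¹ • x) :=
    fun x z hz => (spectrum.smul_mem_smul_iff (r := u)).mpr hz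
  have key2 : ∀ z ∈ spectrum ℂ ((ρ : ℂ)⁻¹ • a), ‖z‖ ≠ 1 := by
    intro z hz hz1
    have h : (ρ : ℂ) * z ∈ spectrum ℂ a := by
      refine (spectrum.smul_mem_smul_iff (r := u)).mp ?_
      simpa [hu, Units.smul_def, hρ.ne'] using hz
    exact ha _ h (by simp [hz1, abs_of_pos hρ])
  obtain ⟨p, b, hp, hcomm, hb, hs⟩ := exists_spectral_idempotent_unit key2
  refine ⟨p, (ρ : ℂ)⁻¹ • b, hp, fun s hs => ?_, ?_, fun z hz => ?_⟩
  · obtain ⟨h1, h2⟩ := hcomm s (hs.smul_right _)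
    exact ⟨h1, h2.smul_right _⟩
  · rw [mul_smul_comm, ← smul_mul_assoc, hb]
  · have h := hs _ (by simpa using key _ z hz)
    rw [norm_mul, norm_inv, Complex.norm_real, Real.norm_of_nonneg hρ.le, inv_mul_lt_iff₀ hρ] at h
    simpa using h

end RieszProjection

/-! ### Direct sums and the three spectra -/

section Splitting

variable {X M N : Type*} [NormedAddCommGroup X] [NormedSpace ℂ X]
  [NormedAddCommGroup M] [NormedSpace ℂ M] [NormedAddCommGroup N] [NormedSpace ℂ N]

/-- `A` is a direct summand of `T`: `i` and `p` are the inclusion and the projection. -/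
structure IsSummand (T : X →L[ℂ] X) (A : M →L[ℂ] M) (i : M →L[ℂ] X) (p : X →L[ℂ] M) : Prop where
  proj_incl : ∀ m, p (i m) = m
  map_incl : ∀ m, T (i m) = i (A m)
  proj_map : ∀ x, p (T x) = A (p x)

/-- `T` is the direct sum of `A` and `B`. -/
structure IsDirectSum (T : X →L[ℂ] X) (A : M →L[ℂ] M) (B : N →L[ℂ] N)
    (i : M →L[ℂ] X) (p : X →L[ℂ] M) (j : N →L[ℂ] X) (q : X →L[ℂ] N) : Prop where
  left : IsSummand T A i p
  right : IsSummand T B j q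
  sum : ∀ x, i (p x) + j (q x) = x

/-- The condition on `T` whose failure for `T - z` defines `z ∈ σ_*(T)`. -/
def IsStarRegular (s : SpectrumKind) (T : X →L[ℂ] X) : Prop :=
  match s with
  | SpectrumKind.ordinary => IsUnit T
  | SpectrumKind.browder => IsBrowder T
  | SpectrumKind.drazin => IsDrazinInvertible T

theorem mem_starSpectrum {s : SpectrumKind} {T : X →L[ℂ] X} {z : ℂ} :
    z ∈ starSpectrum s T ↔ ¬ IsStarRegular s (T - z • (1 : X →L[ℂ] X)) := by
  cases s with
  | ordinary =>
    rw [starSpectrum, spectrum.mem_iff, ← IsUnit.neg_iff, neg_sub,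
      Algebra.algebraMap_eq_smul_one]
    rfl
  | browder => rfl
  | drazin => rfl

/-- Invertibility modulo finite rank is the form of Fredholmness that survives both compression to a
summand and assembly from two summands. -/
theorem isFredholm_iff_exists {T : X →L[ℂ] X} : T.IsFredholm ↔ ∃ V : X →L[ℂ] X,
    ((V * T - 1 : X →L[ℂ] X) : X →ₗ[ℂ] X).HasNoetherianRange ∧
      ((T * V - 1 : X →L[ℂ] X) : X →ₗ[ℂ] X).HasNoetherianRange := by
  rw [ContinuousLinearMap.isFredholm_iff_exists_isQuasiInverse]
  exact exists_congr fun V =>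
    and_congr LinearMap.FiniteRangeSetoid.equiv_iff_hasNoetherianRange
      LinearMap.FiniteRangeSetoid.equiv_iff_hasNoetherianRange

theorem IsUnit.isBrowder {T : X →L[ℂ] X} (h : IsUnit T) : IsBrowder T := by
  obtain ⟨u, rfl⟩ := h
  have hl : ∀ x, (↑u⁻¹ : X →L[ℂ] X) ((u : X →L[ℂ] X) x) = x := fun x =>
    DFunLike.congr_fun u.inv_mul x
  have hr : ∀ x, (u : X →L[ℂ] X) ((↑u⁻¹ : X →L[ℂ] X) x) = x := fun x =>
    DFunLike.congr_fun u.mul_inv x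
  refine ⟨isFredholm_iff_exists.mpr ⟨(↑u⁻¹ : X →L[ℂ] X), by simp, by simp⟩,
    ⟨0, ?_⟩, ⟨0, ?_⟩⟩
  · ext x
    simp only [pow_zero, zero_add, pow_one, LinearMap.mem_ker, ContinuousLinearMap.coe_coe,
      one_apply_eq_self]
    exact ⟨fun h => by simp [h], fun h => by rw [← hl x, h, map_zero]⟩
  · ext x
    simp only [pow_zero, zero_add, pow_one, LinearMap.mem_range, ContinuousLinearMap.coe_coe,
      one_apply_eq_self, exists_eq, true_iff]
    exact ⟨_, hr x⟩

theorem IsUnit.isStarRegular {T : X →L[ℂ] X} (h : IsUnit T) (s : SpectrumKind) :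
    IsStarRegular s T := by
  cases s with
  | ordinary => exact h
  | browder => exact h.isBrowder
  | drazin => exact h.isBrowder.2

theorem IsStarRegular.isDrazinInvertible {s : SpectrumKind} {T : X →L[ℂ] X}
    (h : IsStarRegular s T) : IsDrazinInvertible T := by
  cases s with
  | ordinary => exact (IsUnit.isBrowder h).2
  | browder => exact h.2
  | drazin => exact h

theorem starSpectrum_subset_spectrum (s : SpectrumKind) (T : X →L[ℂ] X) :
    starSpectrum s T ⊆ spectrum ℂ T := fun z hz => by
  change z ∈ starSpectrum SpectrumKind.ordinary T
  rw [mem_starSpectrum] at hz ⊢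
  exact fun h => hz (IsUnit.isStarRegular h s)

theorem hasFiniteAscent_iff {T : X →L[ℂ] X} :
    HasFiniteAscent T ↔ ∃ n : ℕ, ∀ x, (T ^ (n + 1)) x = 0 → (T ^ n) x = 0 := by
  refine exists_congr fun n => ⟨fun h x hx => ?_, fun h => le_antisymm (fun x hx => ?_) h⟩
  · exact h.ge hx
  · have hx' : (T ^ n) x = 0 := hx
    change (T ^ (n + 1)) x = 0
    rw [pow_succ', mul_apply_eq_comp, hx', map_zero]

theorem hasFiniteDescent_iff {T : X →L[ℂ] X} :
    HasFiniteDescent T ↔ ∃ n : ℕ, ∀ x, ∃ y, (T ^ (n + 1)) y = (T ^ n) x := by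
  refine exists_congr fun n => ⟨fun h x => h.le ⟨x, rfl⟩, fun h => le_antisymm ?_ ?_⟩
  · rintro _ ⟨x, rfl⟩
    exact h x
  · rintro _ ⟨x, rfl⟩
    exact ⟨T x, by simp [pow_succ]⟩

theorem ker_stable {T : X →L[ℂ] X} {n : ℕ} (h : ∀ x, (T ^ (n + 1)) x = 0 → (T ^ n) x = 0)
    {m : ℕ} (hm : n ≤ m) : ∀ x, (T ^ (m + 1)) x = 0 → (T ^ m) x = 0 := by
  obtain ⟨k, rfl⟩ := Nat.exists_eq_add_of_le hm
  intro x hx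
  rw [show n + k + 1 = n + 1 + k by ring, pow_add, mul_apply_eq_comp] at hx
  rw [pow_add, mul_apply_eq_comp]
  exact h _ hx

theorem range_stable {T : X →L[ℂ] X} {n : ℕ} (h : ∀ x, ∃ y, (T ^ (n + 1)) y = (T ^ n) x)
    {m : ℕ} (hm : n ≤ m) : ∀ x, ∃ y, (T ^ (m + 1)) y = (T ^ m) x := by
  obtain ⟨k, rfl⟩ := Nat.exists_eq_add_of_le hm
  intro x
  obtain ⟨y, hy⟩ := h x
  refine ⟨y, ?_⟩
  rw [show n + k + 1 = k + (n + 1) by ring, add_comm n k, pow_add T k (n + 1), pow_add T k n,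
    mul_apply_eq_comp, mul_apply_eq_comp, hy]

variable {T : X →L[ℂ] X} {A : M →L[ℂ] M} {B : N →L[ℂ] N}
  {i : M →L[ℂ] X} {p : X →L[ℂ] M} {j : N →L[ℂ] X} {q : X →L[ℂ] N}

namespace IsSummand

theorem sub_smul_one (h : IsSummand T A i p) (z : ℂ) :
    IsSummand (T - z • (1 : X →L[ℂ] X)) (A - z • (1 : M →L[ℂ] M)) i p where
  proj_incl := h.proj_incl
  map_incl m := by simp [h.map_incl]
  proj_map x := by simp [h.proj_map]

theorem map_incl_pow (h : IsSummand T A i p) (n : ℕ) (m : M) :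
    (T ^ n) (i m) = i ((A ^ n) m) := by
  induction n generalizing m with
  | zero => simp
  | succ n ih => rw [pow_succ, pow_succ, mul_apply_eq_comp, mul_apply_eq_comp, h.map_incl, ih]

theorem proj_map_pow (h : IsSummand T A i p) (n : ℕ) (x : X) :
    p ((T ^ n) x) = (A ^ n) (p x) := by
  induction n generalizing x with
  | zero => simp
  | succ n ih => rw [pow_succ, pow_succ, mul_apply_eq_comp, mul_apply_eq_comp, ih, h.proj_map]

theorem hasFiniteAscent (h : IsSummand T A i p) (hT : HasFiniteAscent T) : HasFiniteAscent A := by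
  rw [hasFiniteAscent_iff] at hT ⊢
  obtain ⟨n, hn⟩ := hT
  refine ⟨n, fun m hm => ?_⟩
  rw [← h.proj_incl ((A ^ n) m), ← h.map_incl_pow,
    hn (i m) (by rw [h.map_incl_pow, hm, map_zero]), map_zero]

theorem hasFiniteDescent (h : IsSummand T A i p) (hT : HasFiniteDescent T) :
    HasFiniteDescent A := by
  rw [hasFiniteDescent_iff] at hT ⊢
  obtain ⟨n, hn⟩ := hT
  refine ⟨n, fun m => ?_⟩
  obtain ⟨y, hy⟩ := hn (i m)
  exact ⟨p y, by rw [← h.proj_map_pow, hy, h.proj_map_pow, h.proj_incl]⟩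

theorem isFredholm (h : IsSummand T A i p) (hT : T.IsFredholm) : A.IsFredholm := by
  rw [isFredholm_iff_exists] at hT ⊢
  obtain ⟨V, h1, h2⟩ := hT
  have e1 : ((p ∘L V ∘L i * A - 1 : M →L[ℂ] M) : M →ₗ[ℂ] M) =
      (p : X →ₗ[ℂ] M) ∘ₗ ((V * T - 1 : X →L[ℂ] X) : X →ₗ[ℂ] X) ∘ₗ (i : M →ₗ[ℂ] X) :=
    LinearMap.ext fun m => by simp [h.map_incl, h.proj_incl]
  have e2 : ((A * p ∘L V ∘L i - 1 : M →L[ℂ] M) : M →ₗ[ℂ] M) =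
      (p : X →ₗ[ℂ] M) ∘ₗ ((T * V - 1 : X →L[ℂ] X) : X →ₗ[ℂ] X) ∘ₗ (i : M →ₗ[ℂ] X) :=
    LinearMap.ext fun m => by simp [h.proj_map, h.proj_incl]
  refine ⟨p ∘L V ∘L i, ?_, ?_⟩
  · rw [e1]
    exact (h1.comp_right _).comp_left _
  · rw [e2]
    exact (h2.comp_right _).comp_left _

theorem isUnit (h : IsSummand T A i p) (hT : IsUnit T) : IsUnit A := by
  obtain ⟨u, rfl⟩ := hT
  refine isUnit_iff_exists.mpr ⟨p ∘L (↑u⁻¹ : X →L[ℂ] X) ∘L i, ?_, ?_⟩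
  · ext m
    have : (u : X →L[ℂ] X) ((↑u⁻¹ : X →L[ℂ] X) (i m)) = i m := DFunLike.congr_fun u.mul_inv _
    simp [← h.proj_map, this, h.proj_incl]
  · ext m
    have : (↑u⁻¹ : X →L[ℂ] X) ((u : X →L[ℂ] X) (i m)) = i m := DFunLike.congr_fun u.inv_mul _
    simp [← h.map_incl, this, h.proj_incl]

theorem isStarRegular {s : SpectrumKind} (h : IsSummand T A i p) (hT : IsStarRegular s T) :
    IsStarRegular s A := by
  cases s with
  | ordinary => exact h.isUnit hT
  | browder => exact ⟨h.isFredholm hT.1, h.hasFiniteAscent hT.2.1, h.hasFiniteDescent hT.2.2⟩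
  | drazin => exact ⟨h.hasFiniteAscent hT.1, h.hasFiniteDescent hT.2⟩

theorem starSpectrum_subset (h : IsSummand T A i p) (s : SpectrumKind) :
    starSpectrum s A ⊆ starSpectrum s T := fun z hz => by
  rw [mem_starSpectrum] at hz ⊢
  exact fun hT => hz ((h.sub_smul_one z).isStarRegular hT)

end IsSummand

namespace IsDirectSum

theorem sub_smul_one (h : IsDirectSum T A B i p j q) (z : ℂ) :
    IsDirectSum (T - z • (1 : X →L[ℂ] X)) (A - z • (1 : M →L[ℂ] M)) (B - z • (1 : N →L[ℂ] N))
      i p j q :=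
  ⟨h.left.sub_smul_one z, h.right.sub_smul_one z, h.sum⟩

theorem hasFiniteAscent (h : IsDirectSum T A B i p j q) (hA : HasFiniteAscent A)
    (hB : HasFiniteAscent B) : HasFiniteAscent T := by
  rw [hasFiniteAscent_iff] at hA hB ⊢
  obtain ⟨n, hn⟩ := hA
  obtain ⟨m, hm⟩ := hB
  refine ⟨max n m, fun x hx => ?_⟩
  rw [← h.sum ((T ^ max n m) x), h.left.proj_map_pow, h.right.proj_map_pow,
    ker_stable hn (le_max_left n m) _ (by rw [← h.left.proj_map_pow, hx, map_zero]),
    ker_stable hm (le_max_right n m) _ (by rw [← h.right.proj_map_pow, hx, map_zero])]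
  simp

theorem hasFiniteDescent (h : IsDirectSum T A B i p j q) (hA : HasFiniteDescent A)
    (hB : HasFiniteDescent B) : HasFiniteDescent T := by
  rw [hasFiniteDescent_iff] at hA hB ⊢
  obtain ⟨n, hn⟩ := hA
  obtain ⟨m, hm⟩ := hB
  refine ⟨max n m, fun x => ?_⟩
  obtain ⟨y, hy⟩ := range_stable hn (le_max_left n m) (p x)
  obtain ⟨y', hy'⟩ := range_stable hm (le_max_right n m) (q x)
  refine ⟨i y + j y', ?_⟩
  rw [← h.sum ((T ^ max n m) x), h.left.proj_map_pow, h.right.proj_map_pow, map_add,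
    h.left.map_incl_pow, h.right.map_incl_pow, hy, hy']

theorem isFredholm (h : IsDirectSum T A B i p j q) (hA : A.IsFredholm) (hB : B.IsFredholm) :
    T.IsFredholm := by
  rw [isFredholm_iff_exists] at hA hB ⊢
  obtain ⟨V, h1, h2⟩ := hA
  obtain ⟨W, h3, h4⟩ := hB
  have e1 : (((i ∘L V ∘L p + j ∘L W ∘L q) * T - 1 : X →L[ℂ] X) : X →ₗ[ℂ] X) =
      (i : M →ₗ[ℂ] X) ∘ₗ ((V * A - 1 : M →L[ℂ] M) : M →ₗ[ℂ] M) ∘ₗ (p : X →ₗ[ℂ] M) +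
      (j : N →ₗ[ℂ] X) ∘ₗ ((W * B - 1 : N →L[ℂ] N) : N →ₗ[ℂ] N) ∘ₗ (q : X →ₗ[ℂ] N) :=
    LinearMap.ext fun x => by
      change i (V (p (T x))) + j (W (q (T x))) - x =
        i (V (A (p x)) - p x) + j (W (B (q x)) - q x)
      rw [h.left.proj_map, h.right.proj_map, map_sub, map_sub, sub_add_sub_comm, h.sum]
  have e2 : ((T * (i ∘L V ∘L p + j ∘L W ∘L q) - 1 : X →L[ℂ] X) : X →ₗ[ℂ] X) =
      (i : M →ₗ[ℂ] X) ∘ₗ ((A * V - 1 : M →L[ℂ] M) : M →ₗ[ℂ] M) ∘ₗ (p : X →ₗ[ℂ] M) +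
      (j : N →ₗ[ℂ] X) ∘ₗ ((B * W - 1 : N →L[ℂ] N) : N →ₗ[ℂ] N) ∘ₗ (q : X →ₗ[ℂ] N) :=
    LinearMap.ext fun x => by
      change T (i (V (p x)) + j (W (q x))) - x =
        i (A (V (p x)) - p x) + j (B (W (q x)) - q x)
      rw [map_add, h.left.map_incl, h.right.map_incl, map_sub, map_sub, sub_add_sub_comm, h.sum]
  refine ⟨i ∘L V ∘L p + j ∘L W ∘L q, ?_, ?_⟩
  · rw [e1]
    exact ((h1.comp_right _).comp_left _).add ((h3.comp_right _).comp_left _)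
  · rw [e2]
    exact ((h2.comp_right _).comp_left _).add ((h4.comp_right _).comp_left _)

theorem isUnit (h : IsDirectSum T A B i p j q) (hA : IsUnit A) (hB : IsUnit B) : IsUnit T := by
  obtain ⟨u, rfl⟩ := hA
  obtain ⟨v, rfl⟩ := hB
  have hu1 : ∀ x, (u : M →L[ℂ] M) ((↑u⁻¹ : M →L[ℂ] M) x) = x := DFunLike.congr_fun u.mul_inv
  have hu2 : ∀ x, (↑u⁻¹ : M →L[ℂ] M) ((u : M →L[ℂ] M) x) = x := DFunLike.congr_fun u.inv_mul
  have hv1 : ∀ x, (v : N →L[ℂ] N) ((↑v⁻¹ : N →L[ℂ] N) x) = x := DFunLike.congr_fun v.mul_inv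
  have hv2 : ∀ x, (↑v⁻¹ : N →L[ℂ] N) ((v : N →L[ℂ] N) x) = x := DFunLike.congr_fun v.inv_mul
  refine isUnit_iff_exists.mpr
    ⟨i ∘L (↑u⁻¹ : M →L[ℂ] M) ∘L p + j ∘L (↑v⁻¹ : N →L[ℂ] N) ∘L q, ?_, ?_⟩
  · ext x
    simp [h.left.map_incl, h.right.map_incl, hu1, hv1, h.sum]
  · ext x
    simp [h.left.proj_map, h.right.proj_map, hu2, hv2, h.sum]

theorem isStarRegular {s : SpectrumKind} (h : IsDirectSum T A B i p j q)
    (hA : IsStarRegular s A) (hB : IsStarRegular s B) : IsStarRegular s T := by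
  cases s with
  | ordinary => exact h.isUnit hA hB
  | browder =>
    exact ⟨h.isFredholm hA.1 hB.1, h.hasFiniteAscent hA.2.1 hB.2.1,
      h.hasFiniteDescent hA.2.2 hB.2.2⟩
  | drazin => exact ⟨h.hasFiniteAscent hA.1 hB.1, h.hasFiniteDescent hA.2 hB.2⟩

theorem starSpectrum_eq (h : IsDirectSum T A B i p j q) (s : SpectrumKind) :
    starSpectrum s T = starSpectrum s A ∪ starSpectrum s B := by
  refine subset_antisymm (fun z hz => ?_)
    (union_subset (h.left.starSpectrum_subset s) (h.right.starSpectrum_subset s))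
  by_contra hc
  rw [mem_union, mem_starSpectrum, mem_starSpectrum] at hc
  push Not at hc
  exact mem_starSpectrum.mp hz ((h.sub_smul_one z).isStarRegular hc.1 hc.2)

end IsDirectSum

end Splitting

/-! ### Drazin invertibility and accumulation points of the spectrum -/

section Isolated

variable {X : Type*} [NormedAddCommGroup X] [NormedSpace ℂ X] [CompleteSpace X]

theorem IsUnit.eventually_sub_smul_one {A : Type*} [NormedRing A] [NormedAlgebra ℂ A]
    [CompleteSpace A] {a : A} (ha : IsUnit a) : ∀ᶠ z in 𝓝 (0 : ℂ), IsUnit (a - z • (1 : A)) := by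
  have hc : Continuous fun z : ℂ => a - z • (1 : A) := by fun_prop
  exact (Units.isOpen.preimage hc).mem_nhds (by simpa using ha)

/-- A Drazin invertible operator has bijective small nonzero perturbations `T - z`. -/
theorem IsDrazinInvertible.eventually_isUnit {T : X →L[ℂ] X} (h : IsDrazinInvertible T) :
    ∀ᶠ z in 𝓝[≠] (0 : ℂ), IsUnit (T - z • (1 : X →L[ℂ] X)) := by
  obtain ⟨h1, h2⟩ := h
  rw [hasFiniteAscent_iff] at h1
  rw [hasFiniteDescent_iff] at h2
  obtain ⟨n₁, h1⟩ := h1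
  obtain ⟨n₂, h2⟩ := h2
  set n := max n₁ n₂ with hn
  replace h1 := ker_stable h1 (le_max_left n₁ n₂)
  replace h2 := range_stable h2 (le_max_right n₁ n₂)
  rw [← hn] at h1 h2
  -- On `X ⧸ ker T^n` the induced operator is injective by ascent and surjective by descent. Working
  -- in this quotient requires no closed range and no complement of `K`.
  set K : Submodule ℂ X := (T ^ n).ker with hK
  have hKc : IsClosed (K : Set X) := (T ^ n).isClosed_ker
  have memK : ∀ x, x ∈ K ↔ (T ^ n) x = 0 := fun x => Iff.rfl
  have comm : ∀ x, (T ^ n) (T x) = T ((T ^ n) x) := fun x => by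
    rw [← mul_apply_eq_comp, ← pow_succ, pow_succ', mul_apply_eq_comp]
  have hTK : ∀ x ∈ K, T x ∈ K := fun x hx => by
    rw [memK] at hx ⊢
    rw [comm, hx, map_zero]
  have hle : K ≤ (K.mkQL ∘L T).ker := fun x hx => by
    simpa using hTK x hx
  set S : (X ⧸ K) →L[ℂ] (X ⧸ K) := K.liftQL (K.mkQL ∘L T) hle with hS
  have hSmk : ∀ x, S (K.mkQ x) = K.mkQ (T x) := fun x => rfl
  have hSb : Function.Bijective S := by
    constructor
    · rw [injective_iff_map_eq_zero]
      intro y hy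
      obtain ⟨x, rfl⟩ := K.mkQ_surjective y
      rw [hSmk, Submodule.mkQ_apply, Submodule.Quotient.mk_eq_zero, memK] at hy
      rw [Submodule.mkQ_apply, Submodule.Quotient.mk_eq_zero, memK]
      exact h1 x (by rwa [pow_succ, mul_apply_eq_comp])
    · intro y
      obtain ⟨x, rfl⟩ := K.mkQ_surjective y
      obtain ⟨w, hw⟩ := h2 x
      refine ⟨K.mkQ w, ?_⟩
      rw [hSmk, ← sub_eq_zero, ← map_sub, Submodule.mkQ_apply, Submodule.Quotient.mk_eq_zero,
        memK, map_sub, ← hw, pow_succ, mul_apply_eq_comp, sub_self]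
  have hev : ∀ᶠ z in 𝓝 (0 : ℂ), IsUnit (S - z • (1 : (X ⧸ K) →L[ℂ] (X ⧸ K))) :=
    (ContinuousLinearMap.isUnit_iff_bijective.mpr hSb).eventually_sub_smul_one
  filter_upwards [eventually_nhdsWithin_of_eventually_nhds hev, self_mem_nhdsWithin] with z hz hz0
  have hz0 : z ≠ 0 := hz0
  have hzb := ContinuousLinearMap.isUnit_iff_bijective.mp hz
  have hmk : ∀ x, (S - z • (1 : (X ⧸ K) →L[ℂ] (X ⧸ K))) (K.mkQ x) =
      K.mkQ ((T - z • (1 : X →L[ℂ] X)) x) := fun x => by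
    rw [sub_apply, sub_apply, map_sub, hSmk]
    rfl
  refine ContinuousLinearMap.isUnit_iff_bijective.mpr ⟨?_, fun y => ?_⟩
  · rw [injective_iff_map_eq_zero]
    intro x hx
    -- A solution of `T x = z x` vanishes in the quotient, so `0 = T^n x = z^n x`.
    have hxK : x ∈ K := by
      have h0 : K.mkQ x = 0 := hzb.1 (by rw [hmk, hx, map_zero, map_zero])
      simpa using h0
    have hTx : T x = z • x := by simpa [sub_eq_zero] using hx
    have hpow : ∀ m : ℕ, (T ^ m) x = z ^ m • x := fun m => by
      induction m with
      | zero => simp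
      | succ m ih => rw [pow_succ, mul_apply_eq_comp, hTx, map_smul, ih, smul_smul, pow_succ']
    rw [memK, hpow, smul_eq_zero] at hxK
    exact hxK.resolve_left (pow_ne_zero _ hz0)
  · obtain ⟨x', hx'⟩ := hzb.2 (K.mkQ y)
    obtain ⟨x, rfl⟩ := K.mkQ_surjective x'
    rw [hmk, ← sub_eq_zero, ← map_sub, Submodule.mkQ_apply, Submodule.Quotient.mk_eq_zero,
      memK] at hx'
    -- The error `k` of the lifted solution lies in `ker T^n`. Since `(T - z) G = T^n - z^n`, the
    -- vector `-(z^n)⁻¹ G k` is a preimage of `k` under `T - z` and corrects it.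
    set k := (T - z • (1 : X →L[ℂ] X)) x - y with hk
    set G : X →L[ℂ] X := ∑ i ∈ Finset.range n, T ^ i * (z • 1) ^ (n - 1 - i)
    have hG : (T - z • (1 : X →L[ℂ] X)) (G k) = -(z ^ n • k) := by
      rw [← mul_apply_eq_comp, ((Commute.one_right T).smul_right z).mul_geom_sum₂ n, smul_pow,
        one_pow, sub_apply, hx', zero_sub]
      rfl
    refine ⟨x + (z ^ n)⁻¹ • G k, ?_⟩
    rw [map_add, map_smul, hG, smul_neg, inv_smul_smul₀ (pow_ne_zero _ hz0), hk]
    abel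

theorem derivedSet_spectrum_subset (s : SpectrumKind) (T : X →L[ℂ] X) :
    derivedSet (spectrum ℂ T) ⊆ starSpectrum s T := by
  intro z hz
  rw [mem_starSpectrum]
  intro hreg
  have hev := hreg.isDrazinInvertible.eventually_isUnit
  rw [mem_derivedSet, accPt_iff_frequently_nhdsNE] at hz
  have hmap : Tendsto (fun w => w - z) (𝓝[≠] z) (𝓝[≠] 0) := by
    refine tendsto_nhdsWithin_iff.mpr ⟨?_, ?_⟩
    · have : Tendsto (fun w => w - z) (𝓝 z) (𝓝 (z - z)) := tendsto_id.sub_const z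
      rw [sub_self] at this
      exact this.mono_left nhdsWithin_le_nhds
    · filter_upwards [self_mem_nhdsWithin] with w hw
      exact sub_ne_zero.mpr hw
  refine hz ((hmap.eventually hev).mono fun w hw => ?_)
  rw [spectrum.notMem_iff, ← IsUnit.neg_iff, neg_sub, Algebra.algebraMap_eq_smul_one]
  rwa [sub_sub, ← add_smul, add_sub_cancel] at hw

/-- Closedness follows from `acc σ_* ⊆ acc σ ⊆ σ_*`, uniformly in the three cases. -/
theorem isClosed_starSpectrum (s : SpectrumKind) (T : X →L[ℂ] X) :
    IsClosed (starSpectrum s T) :=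
  (isClosed_iff_derivedSet_subset _).mpr
    ((derivedSet_mono _ _ (starSpectrum_subset_spectrum s T)).trans
      (derivedSet_spectrum_subset s T))

end Isolated

/-! ### Commuting generalized inverses in a ring -/

section CommutingInverse

variable {R : Type*} [Ring R] {s t : R}

theorem mul_mul_eq_self (hc : Commute s t) (hs : s ^ 2 * t = s) : s * t * s = s := by
  rw [mul_assoc, ← hc.eq, ← mul_assoc, ← pow_two, hs]

/-- The idempotent `q = t * s` splits the ring; `s` inverts `t` on the `q` part, so `s + (1 - q)`
inverts the element that is `t` there and the identity on the rest. -/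
theorem isUnit_mul_mul_add_one_sub (hc : Commute s t) (hs : s ^ 2 * t = s) :
    IsUnit (t * (t * s) + (1 - t * s)) := by
  have hst := hc.eq
  have hsq : s * (t * s) = s := by rw [← mul_assoc, mul_mul_eq_self hc hs]
  have hqs : t * s * s = s := by rw [← hst, mul_mul_eq_self hc hs]
  have hqq : t * s * (t * s) = t * s := by rw [mul_assoc, hsq]
  have hqt : t * s * t = t * (t * s) := by rw [mul_assoc, hst]
  -- Making `q` opaque keeps `noncomm_ring` from expanding it.
  obtain ⟨q, hq⟩ : ∃ q, q = t * s := ⟨_, rfl⟩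
  rw [← hq] at hst hsq hqs hqq hqt ⊢
  refine isUnit_iff_exists.mpr ⟨s + (1 - q), ?_, ?_⟩
  · have : (t * q + (1 - q)) * (s + (1 - q)) =
        t * (q * s) + t * (q - q * q) + (s - q * s) + (1 - q - q + q * q) := by noncomm_ring
    rw [this, hqs, hqq, ← hq, sub_self, sub_self, mul_zero]
    abel
  · have : (s + (1 - q)) * (t * q + (1 - q)) =
        s * t * q + (s - s * q) + (t * q - q * t * q) + (1 - q - q + q * q) := by noncomm_ring
    rw [this, hst, hsq, hqt, mul_assoc t q q, hqq, sub_self, sub_self]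
    abel

end CommutingInverse

/-! ### Reducing pairs and the implications -/

section Reduction

variable {X : Type*} [NormedAddCommGroup X] [NormedSpace ℂ X]

theorem isRed_of_isIdempotentElem {P S : X →L[ℂ] X} (hP : IsIdempotentElem P)
    (hS : Commute S P) : IsRed S P.ker P.range := by
  have hPP : ∀ x, P (P x) = P x := DFunLike.congr_fun hP
  have hSP : ∀ x, S (P x) = P (S x) := DFunLike.congr_fun hS.eq
  have hrange : P.range = (1 - P).ker := by
    ext x
    constructor
    · rintro ⟨y, rfl⟩
      exact sub_eq_zero.mpr (hPP y).symm
    · exact fun hx => ⟨x, (sub_eq_zero.mp hx).symm⟩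
  refine ⟨P.isClosed_ker, ?_, fun x hx => ?_, ?_, ?_⟩
  · rw [hrange]
    exact (1 - P).isClosed_ker
  · have hx' : P x = 0 := hx
    change P (S x) = 0
    rw [← hSP, hx', map_zero]
  · rintro _ ⟨x, rfl⟩
    exact ⟨S x, (hSP x).symm⟩
  · refine IsCompl.of_eq (eq_bot_iff.mpr ?_) (eq_top_iff.mpr fun x _ => ?_)
    · rintro _ ⟨hx, x, rfl⟩
      exact (hPP x).symm.trans hx
    · refine Submodule.mem_sup.mpr ⟨x - P x, ?_, P x, ⟨x, rfl⟩, sub_add_cancel _ _⟩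
      change P (x - P x) = 0
      rw [map_sub, hPP, sub_self]

/-- Only an inclusion, because the spectrum is empty when `X` is trivial. -/
theorem spectrum_zero_subset : spectrum ℂ (0 : X →L[ℂ] X) ⊆ {0} := by
  intro z hz
  by_contra hz0
  rw [spectrum.mem_iff, sub_zero] at hz
  exact hz ((isUnit_iff_ne_zero.mpr hz0).map (algebraMap ℂ (X →L[ℂ] X)))

variable [CompleteSpace X]

/-- In a Banach space the projections along closed complements are bounded. -/
theorem IsRed.exists_isDirectSum {T : X →L[ℂ] X} {M N : Submodule ℂ X} (h : IsRed T M N) :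
    ∃ p q, IsDirectSum T (T.restrict h.map_left) (T.restrict h.map_right)
      M.subtypeL p N.subtypeL q := by
  have hc := Submodule.IsCompl.isTopCompl_of_isClosed h.isCompl h.isClosed_left h.isClosed_right
  have hsum : ∀ x, (M.projectionOntoL N hc x : X) + (N.projectionOntoL M hc.symm x : X) = x :=
    fun x => DFunLike.congr_fun (Submodule.projectionL_add_projectionL_eq_id hc) x
  have hT : ∀ x, T x = T (M.projectionOntoL N hc x) + T (N.projectionOntoL M hc.symm x) :=
    fun x => by rw [← map_add, hsum]
  refine ⟨M.projectionOntoL N hc, N.projectionOntoL M hc.symm, ⟨?_, fun _ => rfl, fun x => ?_⟩,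
    ⟨?_, fun _ => rfl, fun x => ?_⟩, hsum⟩
  · exact Submodule.projectionOntoL_apply_left hc
  · rw [hT x, map_add, Submodule.projectionOntoL_apply_eq_zero_of_mem_right hc
      (h.map_right _ (N.projectionOntoL M hc.symm x).2), add_zero]
    exact Submodule.projectionOntoL_apply_left hc (T.restrict h.map_left _)
  · exact Submodule.projectionOntoL_apply_left hc.symm
  · rw [hT x, map_add, Submodule.projectionOntoL_apply_eq_zero_of_mem_right hc.symm
      (h.map_left _ (M.projectionOntoL N hc x).2), zero_add]
    exact Submodule.projectionOntoL_apply_left hc.symm (T.restrict h.map_right _)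

variable {s : SpectrumKind} {γ : Ordinal} {T : X →L[ℂ] X}

theorem cbDeriv_starSpectrum_mono {Y Z : Type*} [NormedAddCommGroup Y] [NormedSpace ℂ Y]
    [NormedAddCommGroup Z] [NormedSpace ℂ Z] {A : Y →L[ℂ] Y} {B : Z →L[ℂ] Z} {i p}
    (h : IsSummand B A i p) : cbDeriv (starSpectrum s A) γ ⊆ cbDeriv (starSpectrum s B) γ :=
  cbDeriv_mono (h.starSpectrum_subset s) γ

theorem zero_notMem_cbDeriv_of_isUnit (h : IsUnit T) : 0 ∉ cbDeriv (starSpectrum s T) γ :=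
  fun h0 => spectrum.zero_notMem ℂ h
    (starSpectrum_subset_spectrum s T (cbDeriv_subset (isClosed_starSpectrum s T) γ h0))

/-- The hypothesis on `M` is weaker than invertibility because (v) controls `T` on `ker P` only
through the `g^γ`-invertibility of `T + P`. -/
theorem IsRed.zero_notMem_cbDeriv {M N : Submodule ℂ X} (h : IsRed T M N)
    (h0 : 0 ∉ cbDeriv (starSpectrum s (T.restrict h.map_left)) γ)
    (hN : cbDeriv (starSpectrum s (T.restrict h.map_right)) γ ⊆ {0}) :
    0 ∉ cbDeriv (starSpectrum s T) (γ + 1) := by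
  obtain ⟨p, q, hd⟩ := h.exists_isDirectSum
  have := h.isClosed_left.completeSpace_coe
  have := h.isClosed_right.completeSpace_coe
  rw [hd.starSpectrum_eq s]
  exact zero_notMem_cbDeriv_union (isClosed_starSpectrum s _) (isClosed_starSpectrum s _) h0 hN

theorem IsGDecomp.zero_notMem_cbDeriv {M N : Submodule ℂ X} (h : IsGDecomp s γ T M N) :
    0 ∉ cbDeriv (starSpectrum s T) (γ + 1) := by
  obtain ⟨hred, hu, hN⟩ := h
  have := hred.isClosed_left.completeSpace_coe
  exact hred.zero_notMem_cbDeriv (zero_notMem_cbDeriv_of_isUnit hu) hN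

theorem IsGInvertible.zero_notMem_cbDeriv {α : Ordinal} (h : IsGInvertible s α T) :
    0 ∉ cbDeriv (starSpectrum s T) α := by
  rcases h with ⟨rfl, h⟩ | ⟨γ, rfl, M, N, h⟩ | ⟨-, γ, hγ, M, N, h⟩
  · rwa [cbDeriv_zero]
  · exact h.zero_notMem_cbDeriv
  · exact fun hc => h.zero_notMem_cbDeriv
      (cbDeriv_antitone (isClosed_starSpectrum s T) hγ.le hc)

theorem IsUnit.isGDecomp (h : IsUnit T) (s : SpectrumKind) (γ : Ordinal) :
    IsGDecomp s γ T ⊤ ⊥ := by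
  have hred : IsRed T ⊤ ⊥ :=
    ⟨isClosed_univ, isClosed_singleton, fun _ _ => trivial, fun x hx => by simp_all,
      isCompl_top_bot⟩
  obtain ⟨p, q, hd⟩ := hred.exists_isDirectSum
  refine ⟨hred, hd.left.isUnit h, cbDeriv_subset_singleton (fun z hz => ?_) γ⟩
  exact absurd (isUnit_of_subsingleton _) (starSpectrum_subset_spectrum s _ hz)

/-- Needed at every ordinal: in (vi) the operator `T + P` is a unit, while the predecessor `γ` may
be zero, a successor or a limit. -/
theorem IsUnit.isGInvertible (h : IsUnit T) (s : SpectrumKind) (α : Ordinal) :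
    IsGInvertible s α T := by
  induction α using Ordinal.limitRecOn with
  | zero => exact Or.inl ⟨rfl, fun h0 =>
      spectrum.zero_notMem ℂ h (starSpectrum_subset_spectrum s T h0)⟩
  | add_one β _ => exact Or.inr (Or.inl ⟨β, rfl, ⊤, ⊥, h.isGDecomp s β⟩)
  | limit δ hδ _ =>
    exact Or.inr (Or.inr ⟨hδ, 0, hδ.add_one_lt (pos_iff_ne_zero.mpr hδ.ne_bot),
      ⊤, ⊥, h.isGDecomp s 0⟩)

/-- If `R` agrees with `T` on the kernel of the commuting idempotent `P`, the conditions
`0 ∉ acc^γ σ_*(R)` and `acc^γ σ_*(TP) ⊆ {0}` give `0 ∉ acc^(γ+1) σ_*(T)`. -/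
theorem zero_notMem_cbDeriv_of_idempotent {P R : X →L[ℂ] X} (hP : IsIdempotentElem P)
    (hTP : Commute T P) (hRP : Commute R P) (hR : ∀ x, P x = 0 → R x = T x)
    (h0 : 0 ∉ cbDeriv (starSpectrum s R) γ) (h : cbDeriv (starSpectrum s (T * P)) γ ⊆ {0}) :
    0 ∉ cbDeriv (starSpectrum s T) (γ + 1) := by
  have hredT := isRed_of_isIdempotentElem hP hTP
  have hredR := isRed_of_isIdempotentElem hP hRP
  have hredTP := isRed_of_isIdempotentElem hP (hTP.mul_left rfl)
  obtain ⟨_, _, hdR⟩ := hredR.exists_isDirectSum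
  obtain ⟨_, _, hdTP⟩ := hredTP.exists_isDirectSum
  have e1 : R.restrict hredR.map_left = T.restrict hredT.map_left := by
    ext x
    exact hR x x.2
  have e2 : (T * P).restrict hredTP.map_right = T.restrict hredT.map_right := by
    ext ⟨_, x, rfl⟩
    exact congrArg T (DFunLike.congr_fun hP x)
  refine hredT.zero_notMem_cbDeriv (s := s) (γ := γ) ?_ ?_
  · rw [← e1]
    exact fun hc => h0 (cbDeriv_starSpectrum_mono hdR.left hc)
  · rw [← e2]
    exact (cbDeriv_starSpectrum_mono hdTP.right).trans h

theorem exists_idempotent_of_zero_notMem_cbDeriv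
    (h : 0 ∉ cbDeriv (starSpectrum s T) (γ + 1)) :
    ∃ P S : X →L[ℂ] X, IsIdempotentElem P ∧ P ∈ comm2 T ∧ S ∈ comm2 T ∧ IsUnit (T + P) ∧
      T * S = 1 - P ∧ S ^ 2 * T = S ∧ IsGDecomp s γ T P.ker P.range ∧
      cbDeriv (starSpectrum s (T * P)) γ ⊆ {0} := by
  obtain ⟨ρ, hρ0, hρ1, hρ, hacc⟩ := exists_sphere_inter_eq_empty (spectrum.isClosed T)
    (derivedSet_spectrum_subset s T) h
  obtain ⟨P, b, hP, hcomm, hb, hspec⟩ := exists_spectral_idempotent hρ0 hρ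
  have hTP : Commute T P := (hcomm T rfl).1
  have hTb : Commute T b := (hcomm T rfl).2
  have hPb : Commute P b := (hcomm P hTP.symm).2
  have hred := isRed_of_isIdempotentElem hP hTP
  have hredP := isRed_of_isIdempotentElem hP (Commute.refl P)
  have hredTP := isRed_of_isIdempotentElem hP (hTP.mul_left rfl)
  have hredb := isRed_of_isIdempotentElem hP hPb.symm
  have hredA := isRed_of_isIdempotentElem hP (hTP.add_left (Commute.refl P))
  have hcM := hred.isClosed_left.completeSpace_coe
  have hcN := hred.isClosed_right.completeSpace_coe
  obtain ⟨_, _, hd⟩ := hred.exists_isDirectSum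
  obtain ⟨_, _, hdTP⟩ := hredTP.exists_isDirectSum
  obtain ⟨_, _, hdA⟩ := hredA.exists_isDirectSum
  have hPN : ∀ x : P.range, P x = x := by
    rintro ⟨_, x, rfl⟩
    exact DFunLike.congr_fun hP x
  have hPM : ∀ x : P.ker, P x = 0 := fun x => x.2
  have hTbx : ∀ x, T (b x) = x - P x := DFunLike.congr_fun hb
  have hbTx : ∀ x, b (T x) = x - P x := fun x => by
    rw [← hTbx]
    exact (DFunLike.congr_fun hTb.eq x).symm
  have huM : IsUnit (T.restrict hred.map_left) := by
    refine isUnit_iff_exists.mpr ⟨b.restrict hredb.map_left, ?_, ?_⟩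
    · ext x
      exact (hTbx x).trans (by simp [hPM])
    · ext x
      exact (hbTx x).trans (by simp [hPM])
  have e1 : (T * P).restrict hredTP.map_right = T.restrict hred.map_right := by
    ext x
    exact congrArg T (hPN x)
  have e2 : (T * P).restrict hredTP.map_left = 0 := by
    ext x
    exact (congrArg T (hPM x)).trans (map_zero T)
  have e3 : (T + P).restrict hredA.map_left = T.restrict hred.map_left := by
    ext x
    exact (congrArg (T x + ·) (hPM x)).trans (add_zero _)
  have e4 : (T + P).restrict hredA.map_right = T.restrict hred.map_right + 1 := by
    ext x
    exact congrArg (T x + ·) (hPN x)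
  -- On `range P` the operator `T * P` is `T`, so the disc bound for `σ(T * P)` passes to `T_N`.
  have hspecN : ∀ z ∈ spectrum ℂ (T.restrict hred.map_right), ‖z‖ < ρ := fun z hz =>
    hspec z (hdTP.right.starSpectrum_subset SpectrumKind.ordinary (by rwa [e1]))
  -- Here `ρ < 1` enters: `-1` is outside the disc, so `T + P`, which is `T_N + 1` on `range P`, is
  -- invertible there.
  have huN : IsUnit (T.restrict hred.map_right + 1) := by
    by_contra hc
    have hm : (-1 : ℂ) ∈ spectrum ℂ (T.restrict hred.map_right) := by
      rw [spectrum.mem_iff, ← IsUnit.neg_iff]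
      simpa using hc
    have := hspecN _ hm
    rw [norm_neg, norm_one] at this
    linarith
  have haccN : cbDeriv (starSpectrum s (T.restrict hred.map_right)) γ ⊆ {0} := fun z hz =>
    hacc z (cbDeriv_starSpectrum_mono hd.right hz) (hspecN z (starSpectrum_subset_spectrum s _
      (cbDeriv_subset (isClosed_starSpectrum s _) γ hz))).le
  -- The generalized inverse is `S = b * (1 - P)`. The factor `1 - P` kills `b` on `range P`, where
  -- nothing makes it an inverse, and yields `S ^ 2 * T = S`.
  have hbP : ∀ R ∈ comm1 T, Commute R (b * (1 - P)) := fun R hR =>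
    (hcomm R hR).2.mul_right ((Commute.one_right R).sub_right (hcomm R hR).1)
  have hq : (1 - P) * (1 - P) = 1 - P := hP.one_sub
  have hTS : T * (b * (1 - P)) = 1 - P := by rw [← mul_assoc, hb, hq]
  refine ⟨P, b * (1 - P), hP, fun R hR => ((hcomm R hR).1).symm, fun R hR => (hbP R hR).symm,
    hdA.isUnit (by rwa [e3]) (by rwa [e4]), hTS, ?_, ⟨hred, huM, haccN⟩, ?_⟩
  · rw [pow_two, mul_assoc, ← (hbP T rfl).eq, hTS, mul_assoc, hq]
  -- `T * P` is `0` on `ker P` and `T_N` on `range P`.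
  · rw [hdTP.starSpectrum_eq s, cbDeriv_union (isClosed_starSpectrum s _)
      (isClosed_starSpectrum s _), e1, e2]
    exact union_subset (cbDeriv_subset_singleton
      ((starSpectrum_subset_spectrum s _).trans spectrum_zero_subset) γ) haccN

theorem exists_isSpectralSet_of_zero_notMem_cbDeriv
    (h : 0 ∉ cbDeriv (starSpectrum s T) (γ + 1)) :
    ∃ A : Set ℂ, IsSpectralSet T A ∧ 0 ∉ spectrum ℂ T \ A ∧ A \ {0} ⊆ specPi s γ T := by
  obtain ⟨ρ, hρ0, -, hρ, hacc⟩ := exists_sphere_inter_eq_empty (spectrum.isClosed T)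
    (derivedSet_spectrum_subset s T) h
  refine ⟨spectrum ℂ T ∩ Metric.closedBall 0 ρ, ⟨inter_subset_left, ?_, ?_⟩, ?_, ?_⟩
  · exact ((spectrum.isClosed T).inter Metric.isClosed_closedBall).preimage continuous_subtype_val
  -- No spectrum lies on the circle, so the closed and open discs cut out the same part of `σ(T)`.
  · have : ((↑) ⁻¹' (spectrum ℂ T ∩ Metric.closedBall 0 ρ) : Set (spectrum ℂ T)) =
        (↑) ⁻¹' (Metric.ball (0 : ℂ) ρ) := by
      ext ⟨z, hz⟩
      simpa [hz] using (lt_iff_le_and_ne.trans (and_iff_left (hρ z hz))).symm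
    rw [this]
    exact Metric.isOpen_ball.preimage continuous_subtype_val
  · exact fun h0 => h0.2 ⟨h0.1, Metric.mem_closedBall_self hρ0.le⟩
  · rintro z ⟨⟨hz, hzρ⟩, hz0⟩
    exact ⟨hz, fun hc => hz0 (hacc z hc (by simpa using hzρ))⟩

/-- If `0` were in `acc^(γ+1) σ_*(T)`, it would lie in `σ(T)`, hence in `A`. Being relatively open,
`A` would contain nonzero points of `acc^γ σ_*(T)`, which `specPi` excludes. -/
theorem IsSpectralSet.zero_notMem_cbDeriv {A : Set ℂ} (hA : IsSpectralSet T A)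
    (h0 : 0 ∉ spectrum ℂ T \ A) (h : A \ {0} ⊆ specPi s γ T) :
    0 ∉ cbDeriv (starSpectrum s T) (γ + 1) := by
  have hsub : cbDeriv (starSpectrum s T) γ ⊆ spectrum ℂ T :=
    (cbDeriv_subset (isClosed_starSpectrum s T) γ).trans (starSpectrum_subset_spectrum s T)
  obtain ⟨U, hU, hUA⟩ := isOpen_induced_iff.mp hA.2.isOpen
  have hUA' : ∀ z ∈ spectrum ℂ T, z ∈ U ↔ z ∈ A := fun z hz =>
    Set.ext_iff.mp hUA ⟨z, hz⟩
  rw [cbDeriv_add_one, mem_derivedSet, accPt_iff_nhds]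
  intro hacc
  have hS : (0 : ℂ) ∈ spectrum ℂ T :=
    (spectrum.isClosed T).closure_subset_iff.mpr hsub (derivedSet_subset_closure _
      (accPt_iff_nhds.mpr hacc))
  have hz0 : (0 : ℂ) ∈ U := (hUA' 0 hS).mpr (by_contra fun hc => h0 ⟨hS, hc⟩)
  obtain ⟨y, ⟨hyU, hy⟩, hy0⟩ := hacc U (hU.mem_nhds hz0)
  exact (h ⟨(hUA' y (hsub hy)).mp hyU, hy0⟩).2 hy

end Reduction

/-! ### The equivalences, with (ii) as hub -/

theorem mainTheorem4 {X : Type*} [NormedAddCommGroup X] [NormedSpace ℂ X] [CompleteSpace X]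
    (s : SpectrumKind) (α γ : Ordinal) (hα : α = γ + 1) (T : X →L[ℂ] X) :
    List.TFAE [
      IsGInvertible s α T,
      0 ∉ cbDeriv (starSpectrum s T) α,
      ∃ M N : Submodule ℂ X, IsRedSq T M N ∧ IsGDecomp s γ T M N,
      ∃ A : Set ℂ, IsSpectralSet T A ∧ 0 ∉ spectrum ℂ T \ A ∧ A \ {0} ⊆ specPi s γ T,
      ∃ P ∈ comm1 T, IsIdempotentElem P ∧ IsGInvertible s γ (T + P) ∧
        cbDeriv (starSpectrum s (T * P)) γ ⊆ {0},
      ∃ P ∈ comm2 T, IsIdempotentElem P ∧ IsGInvertible s γ (T + P) ∧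
        cbDeriv (starSpectrum s (T * P)) γ ⊆ {0},
      ∃ S ∈ comm1 T, S ^ 2 * T = S ∧ cbDeriv (starSpectrum s (T - T ^ 2 * S)) γ ⊆ {0},
      ∃ S ∈ comm2 T, S ^ 2 * T = S ∧ cbDeriv (starSpectrum s (T - T ^ 2 * S)) γ ⊆ {0}] := by
  subst hα
  have h21 : comm2 T ⊆ comm1 T := fun S hS => hS T rfl
  tfae_have 1 → 2 := IsGInvertible.zero_notMem_cbDeriv
  tfae_have 2 → 3 := by
    intro h
    obtain ⟨P, S, hP, hPc, -, -, -, -, hdec, -⟩ := exists_idempotent_of_zero_notMem_cbDeriv h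
    exact ⟨P.ker, P.range,
      fun R hR => isRed_of_isIdempotentElem hP (hPc R hR).symm, hdec⟩
  tfae_have 3 → 1 := by
    rintro ⟨M, N, -, hdec⟩
    exact Or.inr (Or.inl ⟨γ, rfl, M, N, hdec⟩)
  tfae_have 2 → 4 := exists_isSpectralSet_of_zero_notMem_cbDeriv
  tfae_have 4 → 2 := fun ⟨A, hA, h0, h⟩ => hA.zero_notMem_cbDeriv h0 h
  tfae_have 2 → 6 := by
    intro h
    obtain ⟨P, S, hP, hPc, -, hu, -, -, -, hTP⟩ := exists_idempotent_of_zero_notMem_cbDeriv h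
    exact ⟨P, hPc, hP, hu.isGInvertible s γ, hTP⟩
  tfae_have 6 → 5 := fun ⟨P, hPc, h⟩ => ⟨P, h21 hPc, h⟩
  tfae_have 5 → 2 := by
    rintro ⟨P, hPc, hP, hinv, hTP⟩
    have hPT : Commute T P := Commute.symm hPc
    exact zero_notMem_cbDeriv_of_idempotent hP hPT (hPT.add_left (Commute.refl P))
      (fun x hx => by rw [add_apply, hx, add_zero]) hinv.zero_notMem_cbDeriv hTP
  tfae_have 2 → 8 := by
    intro h
    obtain ⟨P, S, hP, -, hSc, -, hTS, hS, -, hTP⟩ := exists_idempotent_of_zero_notMem_cbDeriv h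
    refine ⟨S, hSc, hS, ?_⟩
    -- Since `T * S = 1 - P`, the operator `T - T ^ 2 * S` is `T * P`.
    rwa [pow_two, mul_assoc, hTS, mul_sub, mul_one, sub_sub_cancel]
  tfae_have 8 → 7 := fun ⟨S, hSc, h⟩ => ⟨S, h21 hSc, h⟩
  tfae_have 7 → 2 := by
    rintro ⟨S, hSc, hS, h⟩
    have hQ : IsIdempotentElem (T * S) := by
      rw [IsIdempotentElem, mul_assoc, ← mul_assoc S, mul_mul_eq_self hSc hS]
    have hTQ : Commute T (T * S) := (Commute.refl T).mul_right (Commute.symm hSc)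
    have hTP : Commute T (1 - T * S) := (Commute.one_right T).sub_right hTQ
    have hu := isUnit_mul_mul_add_one_sub hSc hS
    -- The idempotent is `P = 1 - T * S`. The unit `R` is `T` on `ker P` and the identity on `range
    -- P`, so it plays the role that `T + P` has in (v).
    refine zero_notMem_cbDeriv_of_idempotent (R := T * (T * S) + (1 - T * S)) hQ.one_sub hTP
      ?_ ?_ (zero_notMem_cbDeriv_of_isUnit hu) ?_
    · exact (hTP.mul_left ((Commute.one_right _).sub_right rfl)).add_left rfl
    · intro x hx
      have hx' : x = T (S x) := sub_eq_zero.mp hx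
      change T (T (S x)) + (x - T (S x)) = T x
      rw [← hx', sub_self, add_zero]
    · rwa [mul_sub, mul_one, ← mul_assoc, ← pow_two]
  tfae_finish
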